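/- Let $D$ be a probability distribution on $[0,1)$ that has a density (not necessarily bounded) with respect to Lebesgue measure, let $Y_1, Y_2, \ldots$ be independent random variables on a common probability space, each with distribution $D$, and let $x_1 \in [0,1)$. Define the random walk $(X_n)_{n\ge 1}$ on the torus $\mathbb{R}/\mathbb{Z} \cong [0,1)$ by $X_1 = x_1$ and $X_{n+1} = \{X_n + Y_n\}$ for $n \ge 1$, where $\{\cdot\}$ denotes the fractional part. Then, almost surely, $(X_n)_{n\ge 1}$ has Poissonian pair correlations: with probability one, for every $s > 0$, $$\lim_{N\to\infty} \frac{1}{N}\,\#\left\{(i,j) : 1 \le i, j \le N,\ i \ne j,\ \|X_i - X_j\| \le \frac{s}{N}\right\} = 2s,$$ where $\|x\|$ denotes the distance of the real number $x$ to its closest integer. -/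

import Mathlib

open MeasureTheory ProbabilityTheory Filter Topology

noncomputable section

/-- The distance of a real number to its closest integer. -/
def distNearestInt (x : ℝ) : ℝ := |x - (round x : ℝ)|

/-- The pair correlation statistic
`R(s, N) = (1 / N) * #{1 ≤ i ≠ j ≤ N : ‖x_i - x_j‖ ≤ s / N}` of a real sequence, over ordered
pairs of distinct indices. Sequences are indexed from `0`, so that the first `N` terms are
`x 0, …, x (N - 1)`. -/
def pairCorrelation (x : ℕ → ℝ) (s : ℝ) (N : ℕ) : ℝ :=
  (1 / (N : ℝ)) *
    (((Finset.range N ×ˢ Finset.range N).filter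
      (fun p : ℕ × ℕ => p.1 ≠ p.2 ∧ distNearestInt (x p.1 - x p.2) ≤ s / (N : ℝ))).card : ℝ)

/-- Poissonian pair correlations: `R(s, N) → 2 s` as `N → ∞`, for every `s > 0`. -/
def HasPoissonianPairCorrelations (x : ℕ → ℝ) : Prop :=
  ∀ s : ℝ, 0 < s → Tendsto (fun N : ℕ => pairCorrelation x s N) atTop (𝓝 (2 * s))

/-- A Borel measure on the line has a (not necessarily bounded) density with respect to
Lebesgue measure. -/
def HasLebesgueDensity (D : Measure ℝ) : Prop :=
  ∃ f : ℝ → ENNReal, Measurable f ∧ D = volume.withDensity f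

/-- The walk on the torus (represented by `[0, 1)`) with start `x₁` and steps `y 0, y 1, …`:
each step is added modulo `1`. The start is the term with index `0`. -/
def torusWalk (x₁ : ℝ) (y : ℕ → ℝ) : ℕ → ℝ
  | 0 => x₁
  | n + 1 => Int.fract (torusWalk x₁ y n + y n)

end

/-! For i < j the difference of the i-th and j-th positions is, modulo 1 and up to sign, a sum of
the steps i, …, j - 1. The pair count is thus a sum of a periodic window indicator over block sums,
and independence reduces its moments to iterates of `walkOp D`.

Mixing: translation is continuous in L¹, so the density shares mass at least 1/2 with each of its
short translates. Chaining short translates around the circle makes some power of `walkOp D`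
contract oscillation (`exists_contraction`); since Lebesgue measure is stationary, iterates approach
the mean exponentially fast, uniformly over test functions (`exists_mixing`).

Mean: with δ = s / N, a pair at lag m contributes 2δ up to C r^m. The errors summed over lags tend
to 0 by dominated convergence, because each fixed lag has an atomless law; no bound on the density
is needed.

Variance: disjoint blocks are uncorrelated, blocks with L private steps almost so, and the remaining
pairs of pairs cost at most (2L + 1)² times the mean (`variance_pairSum_le`). With N = k⁴ and L = k
the normalized variances are summable, which gives almost sure convergence along fourth powers.
Monotonicity of the unnormalized count fills the gaps. -/

noncomputable section

/-! ### The transition operator on periodic functions -/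

/-- A measurable, `1`-periodic function with values in `[0, 1]`. -/
structure IsUnitPeriodic (φ : ℝ → ℝ) : Prop where
  measurable : Measurable φ
  periodic : Function.Periodic φ 1
  nonneg : ∀ x, 0 ≤ φ x
  le_one : ∀ x, φ x ≤ 1

/-- The transition operator of the random walk on `ℝ` with step distribution `D`. -/
def walkOp (D : Measure ℝ) (φ : ℝ → ℝ) (z : ℝ) : ℝ := ∫ y, φ (z + y) ∂D

/-- The values of `φ` differ by at most `c`. -/
def OscLE (φ : ℝ → ℝ) (c : ℝ) : Prop := ∀ x y, φ x - φ y ≤ c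

namespace IsUnitPeriodic

variable {φ : ℝ → ℝ}

lemma abs_le_one (h : IsUnitPeriodic φ) (x : ℝ) : ‖φ x‖ ≤ 1 := by
  rw [Real.norm_eq_abs, abs_le]
  exact ⟨by linarith [h.nonneg x], h.le_one x⟩

lemma oscLE (h : IsUnitPeriodic φ) : OscLE φ 1 := fun x y => by
  linarith [h.nonneg y, h.le_one x]

lemma integrable_comp {α : Type*} [MeasurableSpace α] {ν : Measure α} [IsFiniteMeasure ν]
    (h : IsUnitPeriodic φ) {g : α → ℝ} (hg : Measurable g) : Integrable (fun a => φ (g a)) ν :=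
  Integrable.of_bound (h.measurable.comp hg).aestronglyMeasurable 1
    (Eventually.of_forall fun _ => h.abs_le_one _)

lemma integral_comp_mem {α : Type*} [MeasurableSpace α] {ν : Measure α} [IsProbabilityMeasure ν]
    (h : IsUnitPeriodic φ) {g : α → ℝ} (hg : Measurable g) :
    0 ≤ ∫ a, φ (g a) ∂ν ∧ ∫ a, φ (g a) ∂ν ≤ 1 := by
  refine ⟨integral_nonneg fun _ => h.nonneg _, ?_⟩
  calc ∫ a, φ (g a) ∂ν ≤ ∫ _, (1 : ℝ) ∂ν :=
        integral_mono (h.integrable_comp hg) (integrable_const _) fun _ => h.le_one _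
    _ = 1 := by simp

lemma walkOp {D : Measure ℝ} [IsProbabilityMeasure D] (h : IsUnitPeriodic φ) :
    IsUnitPeriodic (walkOp D φ) where
  measurable := by
    have : StronglyMeasurable (fun p : ℝ × ℝ => φ (p.1 + p.2)) :=
      (h.measurable.comp (measurable_fst.add measurable_snd)).stronglyMeasurable
    exact this.integral_prod_right.measurable
  periodic z := by
    refine integral_congr_ae (Eventually.of_forall fun y => ?_)
    have := h.periodic (z + y)
    show φ (z + 1 + y) = φ (z + y)
    rw [← this]; ring_nf
  nonneg z := (h.integral_comp_mem (measurable_const_add z)).1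
  le_one z := (h.integral_comp_mem (measurable_const_add z)).2

lemma walkOp_iterate {D : Measure ℝ} [IsProbabilityMeasure D] (h : IsUnitPeriodic φ) (n : ℕ) :
    IsUnitPeriodic ((_root_.walkOp D)^[n] φ) := by
  induction n with
  | zero => exact h
  | succ n ih => rw [Function.iterate_succ_apply']; exact ih.walkOp

/-- Lebesgue measure on the circle is stationary: swap the integrals by Fubini and use translation
invariance over a period. -/
lemma intervalIntegral_walkOp {D : Measure ℝ} [IsProbabilityMeasure D] (h : IsUnitPeriodic φ) :
    ∫ z in (0 : ℝ)..1, _root_.walkOp D φ z = ∫ z in (0 : ℝ)..1, φ z := by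
  have hswap : ∫ z in (0 : ℝ)..1, _root_.walkOp D φ z
      = ∫ y, (∫ z in (0 : ℝ)..1, φ (z + y)) ∂D := by
    simp only [intervalIntegral.integral_of_le zero_le_one, _root_.walkOp]
    have hi : Integrable (Function.uncurry fun z y : ℝ => φ (z + y))
        ((volume.restrict (Set.Ioc 0 1)).prod D) :=
      h.integrable_comp (g := fun p : ℝ × ℝ => p.1 + p.2) (measurable_fst.add measurable_snd)
    exact integral_integral_swap hi
  rw [hswap]
  have : ∀ y, ∫ z in (0 : ℝ)..1, φ (z + y) = ∫ z in (0 : ℝ)..1, φ z := fun y => by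
    rw [intervalIntegral.integral_comp_add_right]
    have := h.periodic.intervalIntegral_add_eq y 0
    simpa [add_comm] using this
  simp only [this, integral_const, probReal_univ, one_smul]

lemma intervalIntegral_walkOp_iterate {D : Measure ℝ} [IsProbabilityMeasure D]
    (h : IsUnitPeriodic φ) (n : ℕ) :
    ∫ z in (0 : ℝ)..1, (_root_.walkOp D)^[n] φ z = ∫ z in (0 : ℝ)..1, φ z := by
  induction n with
  | zero => rfl
  | succ n ih =>
    rw [Function.iterate_succ_apply', (h.walkOp_iterate n).intervalIntegral_walkOp, ih]

lemma abs_sub_intervalIntegral_le (h : IsUnitPeriodic φ) {c : ℝ} (hc : OscLE φ c) (z : ℝ) :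
    |φ z - ∫ x in (0 : ℝ)..1, φ x| ≤ c := by
  have hi : IntervalIntegrable φ volume 0 1 := by
    rw [intervalIntegrable_iff_integrableOn_Ioc_of_le zero_le_one]
    exact h.integrable_comp measurable_id
  have h1 : φ z - ∫ x in (0 : ℝ)..1, φ x = ∫ x in (0 : ℝ)..1, (φ z - φ x) := by
    rw [intervalIntegral.integral_sub (by simp) hi]; simp
  rw [h1]
  have := intervalIntegral.norm_integral_le_of_norm_le_const (a := 0) (b := 1) (C := c)
    (f := fun x => φ z - φ x) (fun x _ => abs_le.2 ⟨by linarith [hc x z], hc z x⟩)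
  simpa using this

end IsUnitPeriodic

/-! ### Contraction of oscillation and exponential mixing -/

lemma OscLE.exists_bounds {φ : ℝ → ℝ} {c : ℝ} (h : OscLE φ c) :
    ∃ a, ∀ x, a ≤ φ x ∧ φ x ≤ a + c := by
  have hb : BddBelow (Set.range φ) := ⟨φ 0 - c, by rintro _ ⟨x, rfl⟩; linarith [h 0 x]⟩
  refine ⟨⨅ x, φ x, fun x => ⟨ciInf_le hb x, ?_⟩⟩
  have : φ x - c ≤ ⨅ y, φ y := le_ciInf fun y => by linarith [h x y]
  linarith

/-- Translation is continuous in `L¹`. -/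
lemma tendsto_integral_abs_sub_translate {g : ℝ → ℝ} (hg : Integrable g) :
    Tendsto (fun d : ℝ => ∫ y, |g (d + y) - g y|) (𝓝 0) (𝓝 0) := by
  have : Fact ((1 : ENNReal) ≠ ⊤) := ⟨by simp⟩
  have hm : MemLp g 1 volume := memLp_one_iff_integrable.2 hg
  have hcont : Continuous (fun d : ℝ => (DomAddAct.mk d) +ᵥ hm.toLp g) := by
    fun_prop
  have h0 := (hcont.tendsto 0).dist (tendsto_const_nhds (x := hm.toLp g))
  have e : ∀ d : ℝ, dist ((DomAddAct.mk d) +ᵥ hm.toLp g) (hm.toLp g)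
      = ∫ y, |g (d + y) - g y| := by
    intro d
    rw [L1.dist_eq_integral_dist]
    refine integral_congr_ae ?_
    have h1 := DomAddAct.vadd_Lp_ae_eq (DomAddAct.mk d) (hm.toLp g)
    have h2 := hm.coeFn_toLp
    have h3 := (measurePreserving_add_left (volume : Measure ℝ) d).quasiMeasurePreserving.ae h2
    filter_upwards [h1, h2, h3] with y e1 e2 e3
    rw [e1, e2, Real.dist_eq]
    exact congrArg (fun t => |t - g y|) e3
  simp only [e] at h0
  convert h0 using 2
  simp


lemma OscLE.nonneg {φ : ℝ → ℝ} {c : ℝ} (h : OscLE φ c) : 0 ≤ c := by simpa using h 0 0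

lemma OscLE.walkOp {D : Measure ℝ} [IsProbabilityMeasure D] {φ : ℝ → ℝ} (hφ : IsUnitPeriodic φ)
    {c : ℝ} (h : OscLE φ c) : OscLE (walkOp D φ) c := fun x y => by
  unfold _root_.walkOp
  rw [← integral_sub (hφ.integrable_comp (measurable_const_add x))
    (hφ.integrable_comp (measurable_const_add y))]
  calc _ ≤ ∫ _, c ∂D := integral_mono ((hφ.integrable_comp (measurable_const_add x)).sub
        (hφ.integrable_comp (measurable_const_add y))) (integrable_const _) fun t => h _ _
    _ = c := by simp

lemma OscLE.walkOp_iterate {D : Measure ℝ} [IsProbabilityMeasure D] {φ : ℝ → ℝ}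
    (hφ : IsUnitPeriodic φ) {c : ℝ} (h : OscLE φ c) (n : ℕ) :
    OscLE ((_root_.walkOp D)^[n] φ) c := by
  induction n with
  | zero => exact h
  | succ n ih => rw [Function.iterate_succ_apply']; exact ih.walkOp (hφ.walkOp_iterate n)

/-- A real-valued probability density of `D`. -/
structure IsRealDensity (D : Measure ℝ) (g : ℝ → ℝ) : Prop where
  nonneg : ∀ x, 0 ≤ g x
  integrable : Integrable g
  integral_eq_one : ∫ x, g x = 1
  integral_eq : ∀ F : ℝ → ℝ, ∫ y, F y ∂D = ∫ y, F y * g y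

lemma HasLebesgueDensity.exists_isRealDensity {D : Measure ℝ} [IsProbabilityMeasure D]
    (h : HasLebesgueDensity D) : ∃ g, IsRealDensity D g := by
  obtain ⟨f, hf, rfl⟩ := h
  have h1 : ∫⁻ x, f x = 1 := by
    rw [← setLIntegral_univ, ← withDensity_apply _ MeasurableSet.univ, measure_univ]
  have hfin : ∀ᵐ x, f x < ⊤ := ae_lt_top hf (by simp [h1])
  have key : ∀ F : ℝ → ℝ, ∫ y, F y ∂(volume.withDensity f) = ∫ y, F y * (f y).toReal := by
    intro F
    rw [integral_withDensity_eq_integral_toReal_smul hf hfin]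
    simp [mul_comm]
  refine ⟨fun x => (f x).toReal, fun _ => ENNReal.toReal_nonneg,
    integrable_toReal_of_lintegral_ne_top hf.aemeasurable (by simp [h1]), ?_, key⟩
  simpa using (key fun _ => 1).symm

/-- One coupling step: if translates by `t` agree up to `(1 - θ) c`, then after a step of the walk
the translates by `d + t` with `d` small agree up to `(1 - θ / 2) c`. -/
lemma IsRealDensity.walkOp_sub_le {D : Measure ℝ} {g : ℝ → ℝ} (hg : IsRealDensity D g)
    {φ : ℝ → ℝ} (hφ : IsUnitPeriodic φ) {c θ d t : ℝ} (hc : OscLE φ c) (hθ : 0 ≤ θ)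
    (hd : ∫ y, |g (-d + y) - g y| ≤ 1) (ht : ∀ z, φ z - φ (z + t) ≤ (1 - θ) * c) (z : ℝ) :
    walkOp D φ z - walkOp D φ (z + (d + t)) ≤ (1 - θ / 2) * c := by
  obtain ⟨a, ha⟩ := hc.exists_bounds
  have hc0 := hc.nonneg
  have hi := hg.integrable
  have hi' : Integrable (fun y => g (-d + y)) := hi.comp_add_left _
  set g' : ℝ → ℝ := fun y => g (-d + y) with hg'
  have hg'1 : ∫ y, g' y = 1 := by
    rw [← hg.integral_eq_one]; exact integral_add_left_eq_self g (-d)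
  set q : ℝ → ℝ := fun y => min (g y) (g' y) with hq
  have hqi : Integrable q := hi.inf hi'
  -- Since min(u, v) = (u + v - |v - u|) / 2, an L¹ distance of at most 1 leaves common mass at
  -- least 1/2.
  have hQ : 1 / 2 ≤ ∫ y, q y := by
    have e : ∀ y, q y = (g y + g' y - |g' y - g y|) / 2 := fun y => by
      rcases le_total (g y) (g' y) with h | h
      · rw [abs_of_nonneg (by linarith), hq]; simp only [min_eq_left h]; ring
      · rw [abs_of_nonpos (by linarith), hq]; simp only [min_eq_right h]; ring
    have : ∫ y, q y = (1 + 1 - ∫ y, |g' y - g y|) / 2 := by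
      simp_rw [e]
      have ha1 : Integrable (fun y => g y + g' y) := hi.add hi'
      have ha2 : Integrable (fun y => |g' y - g y|) := (hi'.sub hi).abs
      rw [integral_div, integral_sub ha1 ha2, integral_add hi hi', hg'1, hg.integral_eq_one]
    rw [this]; linarith
  -- A change of variable moves the shift `d` from the test function to the density.
  have e2 : ∫ y, φ (z + (d + t) + y) * g y = ∫ y, φ (z + t + y) * g' y := by
    rw [← integral_add_left_eq_self (fun y => φ (z + (d + t) + y) * g y) (-d)]
    refine integral_congr_ae (Eventually.of_forall fun y => ?_)
    simp only [hg']; congr 2; ring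
  have hb : ∀ w : ℝ, Integrable (fun y => φ (w + y) * g y) := fun w =>
    hi.bdd_mul (hφ.measurable.comp (measurable_const_add w)).aestronglyMeasurable
      (Eventually.of_forall fun _ => hφ.abs_le_one _)
  have hb' : ∀ w : ℝ, Integrable (fun y => φ (w + y) * g' y) := fun w =>
    hi'.bdd_mul (hφ.measurable.comp (measurable_const_add w)).aestronglyMeasurable
      (Eventually.of_forall fun _ => hφ.abs_le_one _)
  unfold walkOp
  rw [hg.integral_eq, hg.integral_eq, e2, ← integral_sub (hb _) (hb' _)]
  -- On the common mass `q` the two walkers are coupled and `ht` applies; on the uncoupled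
  -- remainders only the range [a, a + c] is used.
  have hpt : ∀ y, φ (z + y) * g y - φ (z + t + y) * g' y
      ≤ ((1 - θ) * c - c) * q y + ((a + c) * g y - a * g' y) := fun y => by
    have h1 : q y ≤ g y := min_le_left _ _
    have h2 : q y ≤ g' y := min_le_right _ _
    have h0 : 0 ≤ q y := le_min (hg.nonneg _) (hg.nonneg _)
    have h3 := ht (z + y)
    rw [show z + y + t = z + t + y by ring] at h3
    have := mul_le_mul_of_nonneg_right h3 h0
    have := mul_le_mul_of_nonneg_right (ha (z + y)).2 (sub_nonneg.2 h1)
    have := mul_le_mul_of_nonneg_right (ha (z + t + y)).1 (sub_nonneg.2 h2)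
    linarith
  have hR : ∫ y, (((1 - θ) * c - c) * q y + ((a + c) * g y - a * g' y))
      = ((1 - θ) * c - c) * (∫ y, q y) + c := by
    have hs : Integrable (fun y => (a + c) * g y - a * g' y) :=
      (hi.const_mul _).sub (hi'.const_mul _)
    rw [integral_add (hqi.const_mul _) hs,
      integral_sub (hi.const_mul _) (hi'.const_mul _)]
    simp only [integral_const_mul, hg'1, hg.integral_eq_one]
    ring
  calc _ ≤ ∫ y, (((1 - θ) * c - c) * q y + ((a + c) * g y - a * g' y)) :=
        integral_mono ((hb _).sub (hb' _))
          ((hqi.const_mul _).add ((hi.const_mul _).sub (hi'.const_mul _))) hpt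
    _ = ((1 - θ) * c - c) * (∫ y, q y) + c := hR
    _ ≤ (1 - θ / 2) * c := by nlinarith [mul_nonneg hθ hc0]

/-- A displacement of size at most nε is cut into n equal parts of size at most ε, each absorbed by
one coupling step; every step halves the gain θ. -/
lemma IsRealDensity.walkOp_iterate_sub_le {D : Measure ℝ} [IsProbabilityMeasure D] {g : ℝ → ℝ}
    (hg : IsRealDensity D g) {ε : ℝ} (hε : ∀ d, |d| ≤ ε → ∫ y, |g (-d + y) - g y| ≤ 1)
    {φ : ℝ → ℝ} (hφ : IsUnitPeriodic φ) {c : ℝ} (hc : OscLE φ c) (n : ℕ) :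
    ∀ d : ℝ, |d| ≤ n * ε → ∀ z,
      (walkOp D)^[n] φ z - (walkOp D)^[n] φ (z + d) ≤ (1 - (1 / 2) ^ n) * c := by
  induction n with
  | zero =>
    intro d hd z
    have : d = 0 := by simpa using hd
    simp [this]
  | succ n ih =>
    intro d hd z
    have hn : (0 : ℝ) < n + 1 := by positivity
    push_cast at hd
    have h1 : |d / (n + 1)| ≤ ε := by
      rw [abs_div, abs_of_pos hn, div_le_iff₀ hn]; linarith
    have h2 : |d * n / (n + 1)| ≤ n * ε := by
      rw [show d * n / (n + 1) = n * (d / (n + 1)) by ring, abs_mul, Nat.abs_cast]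
      exact mul_le_mul_of_nonneg_left h1 (Nat.cast_nonneg _)
    have := hg.walkOp_sub_le (hφ.walkOp_iterate n) (hc.walkOp_iterate hφ n)
      (θ := (1 / 2) ^ n) (by positivity) (hε _ h1) (ih _ h2) z
    rw [Function.iterate_succ_apply', show d = d / (n + 1) + d * n / (n + 1) by field_simp; ring]
    refine this.trans (le_of_eq ?_)
    ring

/-- Iterates of the transition operator of a law with density contract the oscillation. -/
lemma HasLebesgueDensity.exists_contraction {D : Measure ℝ} [IsProbabilityMeasure D]
    (h : HasLebesgueDensity D) : ∃ (K : ℕ) (ρ : ℝ), 0 < K ∧ 0 < ρ ∧ ρ < 1 ∧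
      ∀ φ c, IsUnitPeriodic φ → OscLE φ c → OscLE ((walkOp D)^[K] φ) (ρ * c) := by
  obtain ⟨g, hg⟩ := h.exists_isRealDensity
  have h1 := (tendsto_integral_abs_sub_translate hg.integrable).eventually
    (Iio_mem_nhds (zero_lt_one' ℝ))
  obtain ⟨ε, hε, h2⟩ := Metric.eventually_nhds_iff.1 h1
  have h3 : ∀ d, |d| ≤ ε / 2 → ∫ y, |g (-d + y) - g y| ≤ 1 := fun d hd => by
    refine le_of_lt (h2 ?_)
    rw [Real.dist_eq, sub_zero, abs_neg]; linarith
  -- K moves of length ε / 2 go once around the circle, so any two points are reached modulo 1.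
  obtain ⟨K, hK⟩ := exists_nat_gt (1 / (ε / 2))
  have hK0 : 0 < K := by
    have : (0 : ℝ) < K := lt_trans (by positivity) hK
    exact_mod_cast this
  refine ⟨K, 1 - (1 / 2) ^ K, hK0, ?_, ?_, ?_⟩
  · have : (1 / 2 : ℝ) ^ K < 1 := pow_lt_one₀ (by norm_num) (by norm_num) hK0.ne'
    linarith
  · have : (0 : ℝ) < (1 / 2 : ℝ) ^ K := by positivity
    linarith
  · intro φ c hφ hc x y
    have hf := (hφ.walkOp_iterate (D := D) K).periodic
    have h4 : |Int.fract (y - x)| ≤ K * (ε / 2) := by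
      rw [abs_of_nonneg (Int.fract_nonneg _)]
      rw [div_lt_iff₀ (by positivity)] at hK
      linarith [Int.fract_lt_one (y - x)]
    have h5 := hg.walkOp_iterate_sub_le h3 hφ hc K _ h4 x
    have h6 : (walkOp D)^[K] φ (x + Int.fract (y - x)) = (walkOp D)^[K] φ y := by
      have := hf.sub_int_mul_eq (x := y) ⌊y - x⌋
      rw [← this, Int.fract]; ring_nf
    rwa [h6] at h5

/-- The walk with a density equidistributes exponentially fast. -/
theorem HasLebesgueDensity.exists_mixing {D : Measure ℝ} [IsProbabilityMeasure D]
    (h : HasLebesgueDensity D) : ∃ C r : ℝ, 0 ≤ C ∧ 0 < r ∧ r < 1 ∧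
      ∀ φ, IsUnitPeriodic φ → ∀ (m : ℕ) (z : ℝ),
        |(walkOp D)^[m] φ z - ∫ x in (0 : ℝ)..1, φ x| ≤ C * r ^ m := by
  obtain ⟨K, ρ, hK, hρ0, hρ1, hcon⟩ := h.exists_contraction
  have hKr : (0 : ℝ) < K := by exact_mod_cast hK
  -- One factor ρ is gained per block of K steps; the constant 1 / ρ pays for the incomplete last
  -- block.
  set r : ℝ := ρ ^ ((1 : ℝ) / K) with hr
  have hr0 : 0 < r := Real.rpow_pos_of_pos hρ0 _
  have hr1 : r < 1 := Real.rpow_lt_one hρ0.le hρ1 (by positivity)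
  have hrK : r ^ K = ρ := by
    rw [hr, ← Real.rpow_natCast, ← Real.rpow_mul hρ0.le, one_div_mul_cancel hKr.ne', Real.rpow_one]
  refine ⟨1 / ρ, r, by positivity, hr0, hr1, fun φ hφ m z => ?_⟩
  have hosc : ∀ n, OscLE ((walkOp D)^[K * n] φ) (ρ ^ n) := by
    intro n
    induction n with
    | zero => simpa using hφ.oscLE
    | succ n ih =>
      have := hcon _ _ (hφ.walkOp_iterate (K * n)) ih
      rw [← Function.iterate_add_apply] at this
      rwa [Nat.mul_succ, Nat.add_comm, pow_succ']
  have h1 : OscLE ((walkOp D)^[m] φ) (ρ ^ (m / K)) := by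
    have := (hosc (m / K)).walkOp_iterate (D := D) (hφ.walkOp_iterate _) (m % K)
    rwa [← Function.iterate_add_apply, Nat.mod_add_div] at this
  have h2 := (hφ.walkOp_iterate (D := D) m).abs_sub_intervalIntegral_le h1 z
  rw [hφ.intervalIntegral_walkOp_iterate] at h2
  refine h2.trans ?_
  rw [one_div, inv_mul_eq_div, le_div_iff₀ hρ0, ← pow_succ, ← hrK, ← pow_mul]
  refine pow_le_pow_of_le_one hr0.le hr1.le ?_
  exact (Nat.lt_mul_div_succ m hK).le

/-! ### The window indicator and its iterates -/

/-- The indicator of the points at distance at most `δ` from the integers. -/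
def closeInd (δ x : ℝ) : ℝ := if distNearestInt x ≤ δ then 1 else 0

lemma distNearestInt_eq_min (x : ℝ) : distNearestInt x = min (Int.fract x) (1 - Int.fract x) :=
  abs_sub_round_eq_min x

lemma measurable_distNearestInt : Measurable distNearestInt := by
  have : distNearestInt = fun x => min (Int.fract x) (1 - Int.fract x) :=
    funext distNearestInt_eq_min
  rw [this]
  fun_prop

lemma distNearestInt_add_intCast (x : ℝ) (n : ℤ) : distNearestInt (x + n) = distNearestInt x := by
  simp [distNearestInt_eq_min]

lemma distNearestInt_le_abs_sub (x : ℝ) (n : ℤ) : distNearestInt x ≤ |x - n| := round_le x n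

lemma distNearestInt_neg (x : ℝ) : distNearestInt (-x) = distNearestInt x := by
  have key : ∀ y : ℝ, distNearestInt (-y) ≤ distNearestInt y := fun y => by
    have := distNearestInt_le_abs_sub (-y) (-round y)
    rwa [Int.cast_neg, sub_neg_eq_add, neg_add_eq_sub, abs_sub_comm] at this
  exact le_antisymm (key x) (by simpa using key (-x))

lemma distNearestInt_eq_abs {x : ℝ} (hx : |x| ≤ 1 / 2) : distNearestInt x = |x| := by
  refine le_antisymm (by simpa using distNearestInt_le_abs_sub x 0) ?_
  unfold distNearestInt
  rcases eq_or_ne (round x) 0 with h | h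
  · simp [h]
  · have h1 : (1 : ℝ) ≤ |(round x : ℝ)| := by exact_mod_cast Int.one_le_abs h
    have h2 := abs_sub_abs_le_abs_sub (round x : ℝ) x
    rw [abs_sub_comm] at h2
    linarith

lemma closeInd_isUnitPeriodic (δ : ℝ) : IsUnitPeriodic (closeInd δ) where
  measurable := Measurable.ite (measurableSet_le measurable_distNearestInt measurable_const)
    measurable_const measurable_const
  periodic x := by
    have := distNearestInt_add_intCast x 1
    rw [Int.cast_one] at this
    simp [closeInd, this]
  nonneg x := by unfold closeInd; split_ifs <;> norm_num
  le_one x := by unfold closeInd; split_ifs <;> norm_num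

lemma intervalIntegral_closeInd {δ : ℝ} (h0 : 0 ≤ δ) (h1 : δ < 1 / 2) :
    ∫ x in (0 : ℝ)..1, closeInd δ x = 2 * δ := by
  -- On the period (-1/2, 1/2] the distance to the nearest integer is the absolute value.
  have h2 := (closeInd_isUnitPeriodic δ).periodic.intervalIntegral_add_eq 0 (-(1 / 2))
  rw [zero_add] at h2
  rw [h2, intervalIntegral.integral_of_le (by norm_num)]
  have h3 : ∀ x ∈ Set.Ioc (-(1 / 2) : ℝ) (-(1 / 2) + 1),
      closeInd δ x = (Set.Icc (-δ) δ).indicator (fun _ => (1 : ℝ)) x := fun x hx => by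
    have : |x| ≤ 1 / 2 := abs_le.2 ⟨hx.1.le, by linarith [hx.2]⟩
    simp only [closeInd, distNearestInt_eq_abs this, Set.indicator, Set.mem_Icc, abs_le]
  rw [setIntegral_congr_fun measurableSet_Ioc h3, integral_indicator_const _ measurableSet_Icc,
    measureReal_restrict_apply measurableSet_Icc, Set.inter_eq_left.2]
  · simp [Measure.real, two_mul, ENNReal.toReal_ofReal (by linarith : 0 ≤ δ + δ)]
  · intro x hx
    exact ⟨by linarith [hx.1], by linarith [hx.2]⟩

lemma distNearestInt_pos {x : ℝ} (hx : x ∉ Set.range ((↑) : ℤ → ℝ)) : 0 < distNearestInt x := by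
  refine abs_pos.2 fun h => hx ⟨round x, ?_⟩
  linarith

lemma HasLebesgueDensity.absolutelyContinuous {D : Measure ℝ} (h : HasLebesgueDensity D) :
    D ≪ volume := by
  obtain ⟨f, -, rfl⟩ := h
  exact withDensity_absolutelyContinuous _ _

/-- A law with density gives no mass to the countable set of integer translates, so one step already
sends shrinking windows to 0; dominated convergence propagates this. No rate is claimed, and none is
available for unbounded densities in general. -/
lemma tendsto_walkOp_iterate_closeInd {D : Measure ℝ} [IsProbabilityMeasure D]
    (h : HasLebesgueDensity D) {δ : ℕ → ℝ} (hδ : Tendsto δ atTop (𝓝 0)) (m : ℕ) :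
    ∀ z, Tendsto (fun N => (walkOp D)^[m + 1] (closeInd (δ N)) z) atTop (𝓝 0) := by
  induction m with
  | zero =>
    intro z
    have h0 : ∫ _, (0 : ℝ) ∂D = 0 := by simp
    rw [← h0]
    refine tendsto_integral_of_dominated_convergence (fun _ => 1)
      (fun N => ((closeInd_isUnitPeriodic _).measurable.comp
        (measurable_const_add z)).aestronglyMeasurable) (integrable_const _)
      (fun N => Eventually.of_forall fun y => (closeInd_isUnitPeriodic _).abs_le_one _) ?_
    have hc : ((fun y => z + y) ⁻¹' Set.range ((↑) : ℤ → ℝ)).Countable :=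
      (Set.countable_range _).preimage (add_right_injective z)
    have hn : ∀ᵐ y ∂D, z + y ∉ Set.range ((↑) : ℤ → ℝ) :=
      h.absolutelyContinuous.ae_le (hc.ae_notMem _)
    filter_upwards [hn] with y hy
    refine tendsto_const_nhds.congr' ?_
    filter_upwards [hδ.eventually (Iio_mem_nhds (distNearestInt_pos hy))] with N hN
    simp only [closeInd]
    rw [if_neg (not_le.2 hN)]
  | succ m ih =>
    intro z
    have h0 : ∫ _, (0 : ℝ) ∂D = 0 := by simp
    rw [← h0]
    simp_rw [Function.iterate_succ_apply' _ (m + 1)]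
    refine tendsto_integral_of_dominated_convergence (fun _ => 1)
      (fun N => (((closeInd_isUnitPeriodic _).walkOp_iterate _).measurable.comp
        (measurable_const_add z)).aestronglyMeasurable) (integrable_const _)
      (fun N => Eventually.of_forall fun y =>
        ((closeInd_isUnitPeriodic _).walkOp_iterate _).abs_le_one _) ?_
    exact Eventually.of_forall fun y => ih (z + y)

/-! ### Integrating out steps, and covariances -/

lemma indepFun_sum_pair {Ω : Type*} [MeasurableSpace Ω] {μ : Measure Ω} {Y : ℕ → Ω → ℝ}
    (hY : iIndepFun Y μ) (hm : ∀ n, Measurable (Y n)) {n : ℕ}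
    {I J K : Finset ℕ} (hI : n ∉ I) (hJ : n ∉ J) (hK : n ∉ K) :
    IndepFun (Y n) (fun ω => (∑ i ∈ I, Y i ω + ∑ i ∈ J, Y i ω, ∑ i ∈ K, Y i ω)) μ := by
  set F := I ∪ J ∪ K with hF
  have hd : Disjoint ({n} : Finset ℕ) F := by simp [hF, hI, hJ, hK]
  have h := hY.indepFun_finset {n} F hd hm
  let ext : (F → ℝ) → ℕ → ℝ := fun v i => if h : i ∈ F then v ⟨i, h⟩ else 0
  have hext : ∀ i, Measurable fun v => ext v i := fun i => by
    by_cases hi : i ∈ F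
    · simp only [ext, hi, dite_true]; exact measurable_pi_apply _
    · simp only [ext, hi, dite_false]; exact measurable_const
  have hu : Measurable fun u : ({n} : Finset ℕ) → ℝ => u ⟨n, Finset.mem_singleton_self n⟩ :=
    measurable_pi_apply _
  have hv : Measurable fun v : F → ℝ =>
      (∑ i ∈ I, ext v i + ∑ i ∈ J, ext v i, ∑ i ∈ K, ext v i) :=
    ((Finset.measurable_fun_sum _ fun i _ => hext i).add
      (Finset.measurable_fun_sum _ fun i _ => hext i)).prodMk
      (Finset.measurable_fun_sum _ fun i _ => hext i)
  have h2 := h.comp hu hv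
  have key : ∀ S : Finset ℕ, S ⊆ F → ∀ ω,
      ∑ i ∈ S, ext (fun i : F => Y i ω) i = ∑ i ∈ S, Y i ω := fun S hS ω =>
    Finset.sum_congr rfl fun i hi => by simp [ext, hS hi]
  have heq : (fun ω => (∑ i ∈ I, Y i ω + ∑ i ∈ J, Y i ω, ∑ i ∈ K, Y i ω))
      = (fun v : F → ℝ => (∑ i ∈ I, ext v i + ∑ i ∈ J, ext v i, ∑ i ∈ K, ext v i)) ∘
        fun a (i : F) => Y i a := funext fun ω => by
    simp only [Function.comp]
    rw [key I (by grind), key J (by grind), key K (by grind)]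
  rw [heq]
  exact h2

section Probability

variable {Ω : Type*} [MeasurableSpace Ω] {μ : Measure Ω} [IsProbabilityMeasure μ]
  {D : Measure ℝ} {Y : ℕ → Ω → ℝ}

lemma integral_mul_of_indepFun_add [IsProbabilityMeasure D] {Z A B : Ω → ℝ} (hZ : Measurable Z)
    (hA : Measurable A) (hB : Measurable B) (hind : IndepFun Z (fun ω => (A ω, B ω)) μ)
    (hlaw : μ.map Z = D) {φ ψ : ℝ → ℝ} (hφ : IsUnitPeriodic φ) (hψ : IsUnitPeriodic ψ) :
    ∫ ω, φ (A ω + Z ω) * ψ (B ω) ∂μ = ∫ ω, walkOp D φ (A ω) * ψ (B ω) ∂μ := by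
  have hV : Measurable fun ω => (A ω, B ω) := hA.prodMk hB
  have := Measure.isProbabilityMeasure_map (μ := μ) hV.aemeasurable
  have hprod := hind.map_prod_eq_prod_map_map hZ.aemeasurable hV.aemeasurable
  rw [hlaw] at hprod
  set Φ : ℝ × ℝ × ℝ → ℝ := fun p => φ (p.2.1 + p.1) * ψ p.2.2 with hΦ
  have hΦm : Measurable Φ := by
    have h1 := hφ.measurable
    have h2 := hψ.measurable
    fun_prop
  have e1 : ∫ ω, φ (A ω + Z ω) * ψ (B ω) ∂μ
      = ∫ p, Φ p ∂(μ.map fun ω => (Z ω, (A ω, B ω))) :=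
    (integral_map (hZ.prodMk hV).aemeasurable hΦm.aestronglyMeasurable).symm
  have hΦi : Integrable Φ (D.prod (μ.map fun ω => (A ω, B ω))) :=
    Integrable.of_bound hΦm.aestronglyMeasurable 1 (Eventually.of_forall fun p => by
      rw [hΦ, norm_mul]
      exact mul_le_one₀ (hφ.abs_le_one _) (norm_nonneg _) (hψ.abs_le_one _))
  rw [e1, hprod, integral_prod_symm _ hΦi]
  have e2 : ∀ v : ℝ × ℝ, ∫ y, Φ (y, v) ∂D = walkOp D φ v.1 * ψ v.2 := fun v => by
    simp only [hΦ, integral_mul_const]; rfl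
  simp_rw [e2]
  refine integral_map hV.aemeasurable (Measurable.aestronglyMeasurable ?_)
  have h1 := (hφ.walkOp (D := D)).measurable
  have h2 := hψ.measurable
  fun_prop

/-- The steps in `I` do not enter the second factor, so they can be integrated out one at a time,
each costing one application of `walkOp D`. -/
lemma integral_mul_sum_eq [IsProbabilityMeasure D] (hY : iIndepFun Y μ)
    (hm : ∀ n, Measurable (Y n)) (hlaw : ∀ n, μ.map (Y n) = D) {ψ : ℝ → ℝ}
    (hψ : IsUnitPeriodic ψ) {I J K : Finset ℕ} (hIJ : Disjoint I J) (hIK : Disjoint I K) :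
    ∀ {φ : ℝ → ℝ}, IsUnitPeriodic φ →
    ∫ ω, φ (∑ i ∈ I, Y i ω + ∑ i ∈ J, Y i ω) * ψ (∑ i ∈ K, Y i ω) ∂μ
      = ∫ ω, (walkOp D)^[I.card] φ (∑ i ∈ J, Y i ω) * ψ (∑ i ∈ K, Y i ω) ∂μ := by
  have hs : ∀ S : Finset ℕ, Measurable fun ω => ∑ i ∈ S, Y i ω := fun S =>
    Finset.measurable_fun_sum _ fun i _ => hm i
  induction I using Finset.induction_on with
  | empty => intro φ _; simp
  | insert n I hn ih =>
    intro φ hφ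
    rw [Finset.disjoint_insert_left] at hIJ hIK
    have h1 := integral_mul_of_indepFun_add (hm n) ((hs I).add (hs J)) (hs K)
      (indepFun_sum_pair hY hm hn hIJ.1 hIK.1) (hlaw n) hφ hψ
    rw [Finset.card_insert_of_notMem hn, Function.iterate_succ_apply, ← ih hIJ.2 hIK.2 hφ.walkOp]
    refine Eq.trans (integral_congr_ae (Eventually.of_forall fun ω => ?_)) h1
    simp only [Finset.sum_insert hn, Pi.add_apply]
    ring_nf

end Probability

section Probability

variable {Ω : Type*} [MeasurableSpace Ω] {μ : Measure Ω} [IsProbabilityMeasure μ]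
  {D : Measure ℝ} {Y : ℕ → Ω → ℝ}

lemma isUnitPeriodic_one : IsUnitPeriodic (fun _ => 1) :=
  ⟨measurable_const, fun _ => rfl, fun _ => zero_le_one, fun _ => le_rfl⟩

lemma measurable_sum_steps (hm : ∀ n, Measurable (Y n)) (S : Finset ℕ) :
    Measurable fun ω => ∑ i ∈ S, Y i ω :=
  Finset.measurable_fun_sum _ fun i _ => hm i

lemma IsUnitPeriodic.memLp_sum {φ : ℝ → ℝ} (hφ : IsUnitPeriodic φ)
    (hm : ∀ n, Measurable (Y n)) (S : Finset ℕ) :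
    MemLp (fun ω => φ (∑ i ∈ S, Y i ω)) 2 μ :=
  MemLp.of_bound (hφ.measurable.comp (measurable_sum_steps hm S)).aestronglyMeasurable 1
    (Eventually.of_forall fun _ => hφ.abs_le_one _)

lemma integral_sum_eq_iterate [IsProbabilityMeasure D] (hY : iIndepFun Y μ)
    (hm : ∀ n, Measurable (Y n)) (hlaw : ∀ n, μ.map (Y n) = D) {φ : ℝ → ℝ}
    (hφ : IsUnitPeriodic φ) (S : Finset ℕ) :
    ∫ ω, φ (∑ i ∈ S, Y i ω) ∂μ = (walkOp D)^[S.card] φ 0 := by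
  simpa using integral_mul_sum_eq hY hm hlaw isUnitPeriodic_one (I := S) (J := ∅) (K := ∅)
    (Finset.disjoint_empty_right _) (Finset.disjoint_empty_right _) hφ

lemma covariance_sum_eq_sub {φ : ℝ → ℝ} (hφ : IsUnitPeriodic φ) (hm : ∀ n, Measurable (Y n))
    (S T : Finset ℕ) :
    cov[fun ω => φ (∑ i ∈ S, Y i ω), fun ω => φ (∑ i ∈ T, Y i ω); μ]
      = (∫ ω, φ (∑ i ∈ S, Y i ω) * φ (∑ i ∈ T, Y i ω) ∂μ)
        - (∫ ω, φ (∑ i ∈ S, Y i ω) ∂μ) * ∫ ω, φ (∑ i ∈ T, Y i ω) ∂μ :=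
  covariance_eq_sub (hφ.memLp_sum hm S) (hφ.memLp_sum hm T)

lemma covariance_sum_eq_zero [IsProbabilityMeasure D] (hY : iIndepFun Y μ)
    (hm : ∀ n, Measurable (Y n)) (hlaw : ∀ n, μ.map (Y n) = D) {φ : ℝ → ℝ}
    (hφ : IsUnitPeriodic φ) {S T : Finset ℕ} (hd : Disjoint S T) :
    cov[fun ω => φ (∑ i ∈ S, Y i ω), fun ω => φ (∑ i ∈ T, Y i ω); μ] = 0 := by
  have h := integral_mul_sum_eq hY hm hlaw hφ (I := S) (J := ∅) (K := T)
    (Finset.disjoint_empty_right _) hd hφ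
  simp only [Finset.sum_empty, add_zero, integral_const_mul] at h
  rw [covariance_sum_eq_sub hφ hm, h, integral_sum_eq_iterate hY hm hlaw hφ S, sub_self]

lemma covariance_sum_le_integral {φ : ℝ → ℝ} (hφ : IsUnitPeriodic φ)
    (hm : ∀ n, Measurable (Y n)) (S T : Finset ℕ) :
    cov[fun ω => φ (∑ i ∈ S, Y i ω), fun ω => φ (∑ i ∈ T, Y i ω); μ]
      ≤ ∫ ω, φ (∑ i ∈ S, Y i ω) ∂μ := by
  rw [covariance_sum_eq_sub hφ hm]
  have h1 := hφ.integral_comp_mem (ν := μ) (measurable_sum_steps hm S)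
  have h2 := hφ.integral_comp_mem (ν := μ) (measurable_sum_steps hm T)
  have h3 : ∫ ω, φ (∑ i ∈ S, Y i ω) * φ (∑ i ∈ T, Y i ω) ∂μ ≤ ∫ ω, φ (∑ i ∈ S, Y i ω) ∂μ :=
    integral_mono ((hφ.memLp_sum hm S).integrable_mul (hφ.memLp_sum hm T))
      (hφ.integrable_comp (measurable_sum_steps hm S))
      fun ω => mul_le_of_le_one_right (hφ.nonneg _) (hφ.le_one _)
  nlinarith [mul_nonneg h1.1 h2.1]

/-- Exponential mixing of the walk with step law `D`, uniformly over test functions. -/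
def ExpMixing (D : Measure ℝ) (C r : ℝ) : Prop :=
  ∀ φ, IsUnitPeriodic φ → ∀ (m : ℕ) (z : ℝ),
    |(walkOp D)^[m] φ z - ∫ x in (0 : ℝ)..1, φ x| ≤ C * r ^ m

/-- Integrating out the steps private to `S` replaces φ by a function within τ of its mean M. The
terms M Q cancel, leaving at most 2τQ ≤ 2τ. -/
lemma covariance_sum_le_mixing [IsProbabilityMeasure D] (hY : iIndepFun Y μ)
    (hm : ∀ n, Measurable (Y n)) (hlaw : ∀ n, μ.map (Y n) = D) {φ : ℝ → ℝ}
    (hφ : IsUnitPeriodic φ) {C r : ℝ} (hmix : ExpMixing D C r) (S T : Finset ℕ) :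
    cov[fun ω => φ (∑ i ∈ S, Y i ω), fun ω => φ (∑ i ∈ T, Y i ω); μ]
      ≤ 2 * (C * r ^ (S \ T).card) := by
  set M := ∫ x in (0 : ℝ)..1, φ x
  set τ := C * r ^ (S \ T).card
  have hsplit : ∀ ω, ∑ i ∈ S \ T, Y i ω + ∑ i ∈ S ∩ T, Y i ω = ∑ i ∈ S, Y i ω := fun ω => by
    rw [add_comm, Finset.sum_inter_add_sum_sdiff]
  have hIJ : Disjoint (S \ T) (S ∩ T) := Finset.disjoint_sdiff_inter S T
  have h1 := integral_mul_sum_eq hY hm hlaw hφ hIJ Finset.sdiff_disjoint hφ (K := T)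
  have h2 := integral_mul_sum_eq hY hm hlaw isUnitPeriodic_one hIJ Finset.sdiff_disjoint hφ (K := T)
  simp only [hsplit, mul_one] at h1 h2
  rw [covariance_sum_eq_sub hφ hm, h1, h2]
  set ψ := (walkOp D)^[(S \ T).card] φ
  have hψ : IsUnitPeriodic ψ := hφ.walkOp_iterate _
  have hb : ∀ z, |ψ z - M| ≤ τ := fun z => hmix φ hφ _ z
  set Q := ∫ ω, φ (∑ i ∈ T, Y i ω) ∂μ
  have hQ : 0 ≤ Q ∧ Q ≤ 1 := hφ.integral_comp_mem (ν := μ) (measurable_sum_steps hm T)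
  have hiT : Integrable (fun ω => φ (∑ i ∈ T, Y i ω)) μ :=
    hφ.integrable_comp (measurable_sum_steps hm T)
  have h3 : ∫ ω, ψ (∑ i ∈ S ∩ T, Y i ω) * φ (∑ i ∈ T, Y i ω) ∂μ ≤ (M + τ) * Q := by
    rw [← integral_const_mul]
    refine integral_mono ((hψ.memLp_sum hm _).integrable_mul (hφ.memLp_sum hm T))
      (hiT.const_mul _) fun ω => mul_le_mul_of_nonneg_right ?_ (hφ.nonneg _)
    linarith [(abs_le.1 (hb (∑ i ∈ S ∩ T, Y i ω))).2]
  have h4 : M - τ ≤ ∫ ω, ψ (∑ i ∈ S ∩ T, Y i ω) ∂μ := by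
    calc M - τ = ∫ _, (M - τ) ∂μ := by simp
      _ ≤ _ := integral_mono (integrable_const _)
          (hψ.integrable_comp (measurable_sum_steps hm _)) fun ω => by
            linarith [(abs_le.1 (hb (∑ i ∈ S ∩ T, Y i ω))).1]
  have hτ : 0 ≤ τ := (abs_nonneg _).trans (hb 0)
  nlinarith [mul_le_mul_of_nonneg_right h4 hQ.1, mul_le_mul_of_nonneg_left hQ.2 hτ]

/-! ### Variance of the pair count -/

/-- The pairs `(i, j)` with `i < j < N`. -/
def ltPairs (N : ℕ) : Finset (ℕ × ℕ) :=
  (Finset.range N ×ˢ Finset.range N).filter fun p => p.1 < p.2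

/-- The pairs both of whose entries are within `L` of those of `p`. -/
def nearPairs (L : ℕ) (p : ℕ × ℕ) : Finset (ℕ × ℕ) :=
  Finset.Icc (p.1 - L) (p.1 + L) ×ˢ Finset.Icc (p.2 - L) (p.2 + L)

lemma card_nearPairs_le (L : ℕ) (p : ℕ × ℕ) : (nearPairs L p).card ≤ (2 * L + 1) ^ 2 := by
  rw [nearPairs, Finset.card_product, Nat.card_Icc, Nat.card_Icc, sq]
  exact Nat.mul_le_mul (by omega) (by omega)

lemma card_ltPairs_le (N : ℕ) : (ltPairs N).card ≤ N ^ 2 := by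
  refine (Finset.card_filter_le _ _).trans ?_
  simp [sq]

/-- Some left or right endpoints differ by at least L; as the intervals meet, the stretch between
those endpoints lies in exactly one of them. -/
lemma le_card_sdiff_of_notMem_nearPairs {L : ℕ} {p q : ℕ × ℕ} (hp : p.1 < p.2) (hq : q.1 < q.2)
    (hn : q ∉ nearPairs L p) (hd : ¬Disjoint (Finset.Ico p.1 p.2) (Finset.Ico q.1 q.2)) :
    L ≤ (Finset.Ico p.1 p.2 \ Finset.Ico q.1 q.2).card ∨
      L ≤ (Finset.Ico q.1 q.2 \ Finset.Ico p.1 p.2).card := by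
  obtain ⟨i, j⟩ := p
  obtain ⟨k, l⟩ := q
  simp only at hp hq hd ⊢
  rw [Finset.not_disjoint_iff] at hd
  obtain ⟨x, hx1, hx2⟩ := hd
  rw [Finset.mem_Ico] at hx1 hx2
  have key : ∀ {a b : ℕ} {S : Finset ℕ}, a + L ≤ b → Finset.Ico a b ⊆ S → L ≤ S.card :=
    fun {a b S} h hs => by
      have := Finset.card_le_card hs
      rw [Nat.card_Ico] at this
      omega
  simp only [nearPairs, Finset.mem_product, Finset.mem_Icc] at hn
  have hcases : i + L ≤ k ∨ k + L ≤ i ∨ j + L ≤ l ∨ l + L ≤ j := by omega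
  rcases hcases with h | h | h | h
  · exact Or.inl (key h fun y hy => by simp only [Finset.mem_sdiff, Finset.mem_Ico] at *; omega)
  · exact Or.inr (key h fun y hy => by simp only [Finset.mem_sdiff, Finset.mem_Ico] at *; omega)
  · exact Or.inr (key h fun y hy => by simp only [Finset.mem_sdiff, Finset.mem_Ico] at *; omega)
  · exact Or.inl (key h fun y hy => by simp only [Finset.mem_sdiff, Finset.mem_Ico] at *; omega)

/-- The number of pairs `i < j < N` with `φ` evaluated at the displacement from `i` to `j`. -/
def pairSum (φ : ℝ → ℝ) (Y : ℕ → Ω → ℝ) (N : ℕ) (ω : Ω) : ℝ :=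
  ∑ p ∈ ltPairs N, φ (∑ i ∈ Finset.Ico p.1 p.2, Y i ω)

lemma variance_pairSum_le [IsProbabilityMeasure D] (hY : iIndepFun Y μ)
    (hm : ∀ n, Measurable (Y n)) (hlaw : ∀ n, μ.map (Y n) = D) {φ : ℝ → ℝ}
    (hφ : IsUnitPeriodic φ) {C r : ℝ} (hC : 0 ≤ C) (hr0 : 0 ≤ r) (hr1 : r ≤ 1)
    (hmix : ExpMixing D C r) (N L : ℕ) :
    Var[pairSum φ Y N; μ] ≤ (N : ℝ) ^ 4 * (2 * (C * r ^ L))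
      + (2 * (L : ℝ) + 1) ^ 2 * ∫ ω, pairSum φ Y N ω ∂μ := by
  set E : ℕ × ℕ → ℝ := fun p => ∫ ω, φ (∑ i ∈ Finset.Ico p.1 p.2, Y i ω) ∂μ with hE
  set τ := 2 * (C * r ^ L) with hτ
  have hτ0 : 0 ≤ τ := by positivity
  have hE0 : ∀ p, 0 ≤ E p := fun p =>
    (hφ.integral_comp_mem (ν := μ) (measurable_sum_steps hm _)).1
  have hint : ∫ ω, pairSum φ Y N ω ∂μ = ∑ p ∈ ltPairs N, E p :=
    integral_finsetSum _ fun p _ => hφ.integrable_comp (measurable_sum_steps hm _)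
  have hmem : ∀ p : ℕ × ℕ, MemLp (fun ω => φ (∑ i ∈ Finset.Ico p.1 p.2, Y i ω)) 2 μ :=
    fun p => hφ.memLp_sum hm _
  have hpow : ∀ {n}, L ≤ n → 2 * (C * r ^ n) ≤ τ := fun h => by
    have := pow_le_pow_of_le_one hr0 hr1 h
    rw [hτ]; gcongr
  have hcov : ∀ p ∈ ltPairs N, ∀ q ∈ ltPairs N,
      cov[fun ω => φ (∑ i ∈ Finset.Ico p.1 p.2, Y i ω),
        fun ω => φ (∑ i ∈ Finset.Ico q.1 q.2, Y i ω); μ]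
        ≤ τ + if q ∈ nearPairs L p then E p else 0 := by
    intro p hp q hq
    split_ifs with hn
    · linarith [covariance_sum_le_integral (μ := μ) hφ hm (Finset.Ico p.1 p.2)
        (Finset.Ico q.1 q.2)]
    · rw [add_zero]
      by_cases hd : Disjoint (Finset.Ico p.1 p.2) (Finset.Ico q.1 q.2)
      · rw [covariance_sum_eq_zero hY hm hlaw hφ hd]; exact hτ0
      · rcases le_card_sdiff_of_notMem_nearPairs (Finset.mem_filter.1 hp).2
          (Finset.mem_filter.1 hq).2 hn hd with h | h
        · exact (covariance_sum_le_mixing hY hm hlaw hφ hmix _ _).trans (hpow h)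
        · rw [covariance_comm]
          exact (covariance_sum_le_mixing hY hm hlaw hφ hmix _ _).trans (hpow h)
  have hvar : Var[pairSum φ Y N; μ] = ∑ p ∈ ltPairs N, ∑ q ∈ ltPairs N,
      cov[fun ω => φ (∑ i ∈ Finset.Ico p.1 p.2, Y i ω),
        fun ω => φ (∑ i ∈ Finset.Ico q.1 q.2, Y i ω); μ] := by
    rw [← covariance_self, ← covariance_fun_sum_fun_sum' (fun p _ => hmem p) (fun p _ => hmem p)]
    · rfl
    · exact (memLp_finsetSum _ fun p _ => hmem p).aemeasurable
  rw [hvar, hint, Finset.mul_sum]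
  have hcard : ((ltPairs N).card : ℝ) ≤ (N : ℝ) ^ 2 := by exact_mod_cast card_ltPairs_le N
  have hrow : ∀ p ∈ ltPairs N, ∑ q ∈ ltPairs N,
      cov[fun ω => φ (∑ i ∈ Finset.Ico p.1 p.2, Y i ω),
        fun ω => φ (∑ i ∈ Finset.Ico q.1 q.2, Y i ω); μ]
      ≤ (N : ℝ) ^ 2 * τ + (2 * (L : ℝ) + 1) ^ 2 * E p := by
    intro p hp
    refine (Finset.sum_le_sum (hcov p hp)).trans ?_
    rw [Finset.sum_add_distrib, Finset.sum_const, nsmul_eq_mul, ← Finset.sum_filter,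
      Finset.sum_const, nsmul_eq_mul]
    have h1 : (((ltPairs N).filter fun q => q ∈ nearPairs L p).card : ℝ)
        ≤ (2 * (L : ℝ) + 1) ^ 2 := by
      have : ((ltPairs N).filter fun q => q ∈ nearPairs L p).card ≤ (2 * L + 1) ^ 2 :=
        (Finset.card_le_card fun q hq => (Finset.mem_filter.1 hq).2).trans
          (card_nearPairs_le L p)
      exact_mod_cast this
    exact add_le_add (mul_le_mul_of_nonneg_right hcard hτ0)
      (mul_le_mul_of_nonneg_right h1 (hE0 p))
  refine (Finset.sum_le_sum hrow).trans ?_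
  rw [Finset.sum_add_distrib, Finset.sum_const, nsmul_eq_mul]
  have : ((ltPairs N).card : ℝ) * ((N : ℝ) ^ 2 * τ) ≤ (N : ℝ) ^ 4 * τ := by
    calc _ ≤ (N : ℝ) ^ 2 * ((N : ℝ) ^ 2 * τ) := mul_le_mul_of_nonneg_right hcard (by positivity)
      _ = _ := by ring
  linarith

end Probability

/-! ### From the torus walk to block sums -/

lemma closeInd_neg (δ x : ℝ) : closeInd δ (-x) = closeInd δ x := by
  simp only [closeInd, distNearestInt_neg]

lemma closeInd_add_intCast (δ x : ℝ) (n : ℤ) : closeInd δ (x + n) = closeInd δ x := by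
  simp only [closeInd, distNearestInt_add_intCast]

lemma exists_torusWalk_eq (x₁ : ℝ) (y : ℕ → ℝ) (n : ℕ) :
    ∃ m : ℤ, torusWalk x₁ y n = x₁ + ∑ i ∈ Finset.range n, y i + m := by
  induction n with
  | zero => exact ⟨0, by simp [torusWalk]⟩
  | succ n ih =>
    obtain ⟨m, hm⟩ := ih
    refine ⟨m - ⌊torusWalk x₁ y n + y n⌋, ?_⟩
    rw [torusWalk, Int.fract, Finset.sum_range_succ, hm]
    push_cast
    ring

lemma closeInd_torusWalk_sub (x₁ : ℝ) (y : ℕ → ℝ) (δ : ℝ) {i j : ℕ} (hij : i ≤ j) :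
    closeInd δ (torusWalk x₁ y i - torusWalk x₁ y j) = closeInd δ (∑ n ∈ Finset.Ico i j, y n) := by
  obtain ⟨a, ha⟩ := exists_torusWalk_eq x₁ y i
  obtain ⟨b, hb⟩ := exists_torusWalk_eq x₁ y j
  have hs := Finset.sum_range_add_sum_Ico y hij
  rw [← closeInd_neg, ← closeInd_add_intCast δ (∑ n ∈ Finset.Ico i j, y n) (b - a), ha, hb]
  congr 1
  push_cast
  linarith

lemma sum_ltPairs_eq (f : ℕ × ℕ → ℝ) (N : ℕ) :
    ∑ p ∈ ltPairs N, f p = ∑ j ∈ Finset.range N, ∑ i ∈ Finset.range j, f (i, j) := by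
  rw [ltPairs, Finset.sum_filter, Finset.sum_product_right]
  refine Finset.sum_congr rfl fun j hj => ?_
  rw [← Finset.sum_filter]
  refine Finset.sum_congr ?_ fun _ _ => rfl
  ext i
  simp only [Finset.mem_filter, Finset.mem_range] at *
  omega

lemma pairCorrelation_torusWalk {Ω : Type*} (Y : ℕ → Ω → ℝ) (x₁ s : ℝ) (N : ℕ) (ω : Ω) :
    pairCorrelation (torusWalk x₁ fun n => Y n ω) s N
      = 2 / N * pairSum (closeInd (s / N)) Y N ω := by
  set δ := s / (N : ℝ)
  set x := torusWalk x₁ fun n => Y n ω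
  have h1 : (((Finset.range N ×ˢ Finset.range N).filter
      (fun p : ℕ × ℕ => p.1 ≠ p.2 ∧ distNearestInt (x p.1 - x p.2) ≤ δ)).card : ℝ)
      = ∑ p ∈ (Finset.range N ×ˢ Finset.range N).filter (fun p => p.1 ≠ p.2),
          closeInd δ (x p.1 - x p.2) := by
    rw [← Finset.filter_filter, Finset.card_filter]
    push_cast
    rfl
  have h2 : (Finset.range N ×ˢ Finset.range N).filter (fun p => p.1 ≠ p.2)
      = ltPairs N ∪ (ltPairs N).map (Equiv.prodComm ℕ ℕ).toEmbedding := by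
    ext ⟨i, j⟩
    simp only [ltPairs, Finset.mem_filter, Finset.mem_product, Finset.mem_range, Finset.mem_union,
      Finset.mem_map_equiv, Equiv.prodComm_symm, Equiv.prodComm_apply, Prod.swap]
    omega
  have h3 : Disjoint (ltPairs N) ((ltPairs N).map (Equiv.prodComm ℕ ℕ).toEmbedding) := by
    rw [Finset.disjoint_left]
    rintro ⟨i, j⟩ hp hq
    simp only [ltPairs, Finset.mem_filter, Finset.mem_map_equiv, Equiv.prodComm_symm,
      Equiv.prodComm_apply, Prod.swap] at hp hq
    omega
  have h4 : ∀ p ∈ ltPairs N, closeInd δ (x p.1 - x p.2)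
      = closeInd δ (∑ n ∈ Finset.Ico p.1 p.2, Y n ω) := fun p hp =>
    closeInd_torusWalk_sub x₁ (fun n => Y n ω) δ (Finset.mem_filter.1 hp).2.le
  have h5 : ∀ p ∈ ltPairs N, closeInd δ (x p.2 - x p.1)
      = closeInd δ (∑ n ∈ Finset.Ico p.1 p.2, Y n ω) := fun p hp => by
    rw [← h4 p hp, ← closeInd_neg, neg_sub]
  rw [pairCorrelation, h1, h2, Finset.sum_union h3, Finset.sum_map]
  simp only [Equiv.coe_toEmbedding, Equiv.prodComm_apply, Prod.fst_swap, Prod.snd_swap]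
  rw [Finset.sum_congr rfl h4, Finset.sum_congr rfl h5, pairSum]
  ring

/-! ### The mean pair count -/

/-- Dominated convergence over lags, with the geometric mixing bound as majorant. Lags start at 1:
the lag-0 term would tend to 1. -/
lemma ExpMixing.tendsto_tsum {D : Measure ℝ} [IsProbabilityMeasure D]
    (h : HasLebesgueDensity D) {C r : ℝ} (hr0 : 0 ≤ r) (hr1 : r < 1) (hmix : ExpMixing D C r)
    {δ : ℕ → ℝ} (hδ : Tendsto δ atTop (𝓝 0)) (hδ0 : ∀ N, 0 ≤ δ N) :
    Tendsto (fun N => ∑' m : ℕ, |(walkOp D)^[m + 1] (closeInd (δ N)) 0 - 2 * δ N|) atTop (𝓝 0) := by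
  have hsum : Summable fun m : ℕ => C * r ^ (m + 1) :=
    ((summable_nat_add_iff 1).2 (summable_geometric_of_lt_one hr0 hr1)).mul_left C
  have := tendsto_tsum_of_dominated_convergence (𝓕 := atTop)
    (f := fun (N m : ℕ) => |(walkOp D)^[m + 1] (closeInd (δ N)) 0 - 2 * δ N|) (g := fun _ => 0)
    hsum (fun m => ?_) ?_
  · simpa using this
  · simpa using ((tendsto_walkOp_iterate_closeInd h hδ m 0).sub (hδ.const_mul 2)).abs
  · filter_upwards [hδ.eventually (Iio_mem_nhds (by norm_num : (0 : ℝ) < 1 / 2))] with N hN m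
    rw [Real.norm_eq_abs, abs_abs, ← intervalIntegral_closeInd (hδ0 N) hN]
    exact hmix _ (closeInd_isUnitPeriodic _) _ _

lemma ExpMixing.summable {D : Measure ℝ} {C r : ℝ} (hr0 : 0 ≤ r) (hr1 : r < 1)
    (hmix : ExpMixing D C r) {δ : ℝ} (h0 : 0 ≤ δ) (h1 : δ < 1 / 2) :
    Summable fun m : ℕ => |(walkOp D)^[m + 1] (closeInd δ) 0 - 2 * δ| := by
  refine Summable.of_nonneg_of_le (fun _ => abs_nonneg _) (fun m => ?_)
    (((summable_nat_add_iff 1).2 (summable_geometric_of_lt_one hr0 hr1)).mul_left C)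
  rw [← intervalIntegral_closeInd h0 h1]
  exact hmix _ (closeInd_isUnitPeriodic _) _ _

section Probability

variable {Ω : Type*} [MeasurableSpace Ω] {μ : Measure Ω} [IsProbabilityMeasure μ]
  {D : Measure ℝ} {Y : ℕ → Ω → ℝ}

lemma integral_pairSum [IsProbabilityMeasure D] (hY : iIndepFun Y μ)
    (hm : ∀ n, Measurable (Y n)) (hlaw : ∀ n, μ.map (Y n) = D) {φ : ℝ → ℝ}
    (hφ : IsUnitPeriodic φ) (N : ℕ) :
    ∫ ω, pairSum φ Y N ω ∂μ
      = ∑ j ∈ Finset.range N, ∑ m ∈ Finset.range j, (walkOp D)^[m + 1] φ 0 := by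
  have h1 : ∫ ω, pairSum φ Y N ω ∂μ = ∑ p ∈ ltPairs N, (walkOp D)^[p.2 - p.1] φ 0 := by
    unfold pairSum
    rw [integral_finsetSum _ fun p _ => hφ.integrable_comp (measurable_sum_steps hm _)]
    simp_rw [integral_sum_eq_iterate hY hm hlaw hφ, Nat.card_Ico]
  rw [h1, sum_ltPairs_eq]
  refine Finset.sum_congr rfl fun j _ => ?_
  rw [← Finset.sum_range_reflect]
  refine Finset.sum_congr rfl fun i hi => ?_
  rw [Finset.mem_range] at hi
  show (walkOp D)^[j - (j - 1 - i)] φ 0 = _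
  rw [show j - (j - 1 - i) = i + 1 by omega]

lemma tendsto_integral_pairSum [IsProbabilityMeasure D] (h : HasLebesgueDensity D)
    (hY : iIndepFun Y μ) (hm : ∀ n, Measurable (Y n)) (hlaw : ∀ n, μ.map (Y n) = D)
    {C r : ℝ} (hr0 : 0 ≤ r) (hr1 : r < 1) (hmix : ExpMixing D C r) {s : ℝ} (hs : 0 < s) :
    Tendsto (fun N : ℕ => 2 / (N : ℝ) * ∫ ω, pairSum (closeInd (s / N)) Y N ω ∂μ)
      atTop (𝓝 (2 * s)) := by
  have hδ : Tendsto (fun N : ℕ => s / (N : ℝ)) atTop (𝓝 0) :=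
    tendsto_const_div_atTop_nhds_zero_nat s
  have hδ0 : ∀ N : ℕ, 0 ≤ s / (N : ℝ) := fun N => by positivity
  have hT := (hmix.tendsto_tsum h hr0 hr1 hδ hδ0).const_mul 2
  have hmain : Tendsto (fun N : ℕ => 2 * s - 2 * (s / (N : ℝ))) atTop (𝓝 (2 * s)) := by
    simpa using tendsto_const_nhds.sub (hδ.const_mul 2)
  have hdiff : Tendsto (fun N : ℕ => 2 / (N : ℝ) * (∫ ω, pairSum (closeInd (s / N)) Y N ω ∂μ)
      - (2 * s - 2 * (s / (N : ℝ)))) atTop (𝓝 0) := by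
    rw [mul_zero] at hT
    refine squeeze_zero_norm' ?_ hT
    filter_upwards [hδ.eventually (Iio_mem_nhds (by norm_num : (0 : ℝ) < 1 / 2)),
      eventually_gt_atTop 0] with N hN hN0
    have hNr : (0 : ℝ) < N := by exact_mod_cast hN0
    rw [integral_pairSum hY hm hlaw (closeInd_isUnitPeriodic _)]
    set δ := s / (N : ℝ) with hδdef
    set T := ∑' m : ℕ, |(walkOp D)^[m + 1] (closeInd δ) 0 - 2 * δ|
    have hsum := hmix.summable hr0 hr1 (hδ0 N) hN
    have e1 : ∑ j ∈ Finset.range N, ∑ m ∈ Finset.range j, (walkOp D)^[m + 1] (closeInd δ) 0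
        = ∑ j ∈ Finset.range N, ∑ m ∈ Finset.range j,
            ((walkOp D)^[m + 1] (closeInd δ) 0 - 2 * δ) + N * (N - 1) * δ := by
      have hg : (∑ j ∈ Finset.range N, (j : ℝ)) * 2 = N * (N - 1) := by
        have := Finset.sum_range_id_mul_two N
        have h2 : ((∑ j ∈ Finset.range N, j : ℕ) : ℝ) * 2 = N * ((N - 1 : ℕ) : ℝ) := by
          exact_mod_cast this
        rw [Nat.cast_sub hN0] at h2
        push_cast at h2
        exact h2
      simp only [Finset.sum_sub_distrib, Finset.sum_const, Finset.card_range, nsmul_eq_mul,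
        ← Finset.sum_mul]
      rw [← hg]; ring
    -- The N(N - 1) / 2 pairs contribute 2δ each; the diagonal accounts for the defect 2δ.
    have e2 : 2 / (N : ℝ) * (N * (N - 1) * δ) = 2 * s - 2 * δ := by
      rw [hδdef]; field_simp
    rw [e1, mul_add, e2, add_sub_cancel_right, Real.norm_eq_abs, abs_mul,
      abs_of_nonneg (by positivity : 0 ≤ 2 / (N : ℝ))]
    have e3 : |∑ j ∈ Finset.range N, ∑ m ∈ Finset.range j,
        ((walkOp D)^[m + 1] (closeInd δ) 0 - 2 * δ)| ≤ N * T := by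
      calc _ ≤ ∑ j ∈ Finset.range N, |∑ m ∈ Finset.range j,
            ((walkOp D)^[m + 1] (closeInd δ) 0 - 2 * δ)| := Finset.abs_sum_le_sum_abs _ _
        _ ≤ ∑ j ∈ Finset.range N, T := Finset.sum_le_sum fun j _ =>
            (Finset.abs_sum_le_sum_abs _ _).trans
              (hsum.sum_le_tsum _ fun _ _ => abs_nonneg _)
        _ = N * T := by simp
    calc _ ≤ 2 / (N : ℝ) * (N * T) := mul_le_mul_of_nonneg_left e3 (by positivity)
      _ = 2 * T := by field_simp
  simpa using hdiff.add hmain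

/-! ### Almost sure convergence along fourth powers -/

/-- Random variables with summable variances converge almost surely if their means do. -/
lemma ae_tendsto_of_summable_variance {X : ℕ → Ω → ℝ} (hX : ∀ k, MemLp (X k) 2 μ)
    (hvar : Summable fun k => Var[X k; μ]) {a : ℝ}
    (hmean : Tendsto (fun k => ∫ ω, X k ω ∂μ) atTop (𝓝 a)) :
    ∀ᵐ ω ∂μ, Tendsto (fun k => X k ω) atTop (𝓝 a) := by
  have hfin : ∑' k, evariance (X k) μ ≠ ⊤ := by
    simp_rw [← fun k => (hX k).ofReal_variance_eq]
    exact hvar.tsum_ofReal_ne_top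
  have hmeas : ∀ k, AEMeasurable (fun ω => ‖X k ω - ∫ ω, X k ω ∂μ‖ₑ ^ 2) μ := fun k =>
    ((hX k).aemeasurable.sub_const _).enorm.pow_const 2
  have hae : ∀ᵐ ω ∂μ, ∑' k, ‖X k ω - ∫ ω, X k ω ∂μ‖ₑ ^ 2 < ⊤ := by
    refine ae_lt_top' (AEMeasurable.tsum hmeas) ?_
    rw [lintegral_tsum hmeas]
    exact hfin
  filter_upwards [hae] with ω hω
  have h0 := ENNReal.tendsto_atTop_zero_of_tsum_ne_top hω.ne
  have h1 : Tendsto (fun k => (X k ω - ∫ ω, X k ω ∂μ) ^ 2) atTop (𝓝 0) := by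
    have := (ENNReal.tendsto_toReal ENNReal.zero_ne_top).comp h0
    simpa [Function.comp_def] using this
  have h2 : Tendsto (fun k => X k ω - ∫ ω, X k ω ∂μ) atTop (𝓝 0) := by
    have := h1.sqrt
    simp only [Real.sqrt_sq_eq_abs, Real.sqrt_zero] at this
    exact tendsto_zero_iff_abs_tendsto_zero _ |>.2 this
  simpa using h2.add hmean

lemma ae_tendsto_pairSum_pow_four [IsProbabilityMeasure D] (h : HasLebesgueDensity D)
    (hY : iIndepFun Y μ) (hm : ∀ n, Measurable (Y n)) (hlaw : ∀ n, μ.map (Y n) = D)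
    {s : ℝ} (hs : 0 < s) :
    ∀ᵐ ω ∂μ, Tendsto (fun k : ℕ => 2 / ((k ^ 4 : ℕ) : ℝ) *
      pairSum (closeInd (s / (k ^ 4 : ℕ))) Y (k ^ 4) ω) atTop (𝓝 (2 * s)) := by
  obtain ⟨C, r, hC, hr0, hr1, hmix⟩ := h.exists_mixing
  have hE := tendsto_integral_pairSum h hY hm hlaw hr0.le hr1 hmix hs
  obtain ⟨B, hB⟩ := hE.bddAbove_range
  have hB' : ∀ N : ℕ, 2 / (N : ℝ) * ∫ ω, pairSum (closeInd (s / N)) Y N ω ∂μ ≤ B :=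
    fun N => hB ⟨N, rfl⟩
  obtain ⟨n, hn⟩ : ∃ n : ℕ → ℕ, ∀ k, n k = k ^ 4 := ⟨_, fun _ => rfl⟩
  have hnr : ∀ k, (n k : ℝ) = (k : ℝ) ^ 4 := fun k => by rw [hn]; push_cast; rfl
  simp_rw [← hn]
  have hpow : Tendsto n atTop atTop := by
    simp_rw [funext hn]
    exact tendsto_pow_atTop (by norm_num)
  have hmem : ∀ (δ : ℝ) (N : ℕ), MemLp (pairSum (closeInd δ) Y N) 2 μ := fun δ N => by
    unfold pairSum
    exact memLp_finsetSum _ fun p _ => (closeInd_isUnitPeriodic δ).memLp_sum hm _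
  refine ae_tendsto_of_summable_variance (fun k => (hmem _ _).const_mul _) ?_ ?_
  · have hr : ‖r‖ < 1 := by rwa [Real.norm_eq_abs, abs_of_pos hr0]
    have hs0 : Summable fun k : ℕ => (k : ℝ) ^ 8 * r ^ k :=
      summable_pow_mul_geometric_of_norm_lt_one 8 hr
    have hs1 : Summable fun k : ℕ => 8 * C * ((k : ℝ) ^ 8 * r ^ k) := hs0.mul_left _
    have hs2 : Summable fun k : ℕ => 18 * B * (1 / (k : ℝ) ^ 2) :=
      (Real.summable_one_div_nat_pow.2 (by norm_num)).mul_left _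
    refine Summable.of_nonneg_of_le (fun k => variance_nonneg _ _) (fun k => ?_) (hs1.add hs2)
    rw [variance_const_mul]
    -- Taking L = k makes N⁴ r^L harmless after normalization, while L² / N is of order k⁻².
    have hv := variance_pairSum_le (μ := μ) hY hm hlaw
      (closeInd_isUnitPeriodic (s / n k)) hC hr0.le hr1.le hmix (n k) k
    rcases Nat.eq_zero_or_pos k with rfl | hk
    · simp [hn]
    have hkr : (1 : ℝ) ≤ k := by exact_mod_cast hk
    have hBk := hB' (n k)
    set I := ∫ ω, pairSum (closeInd (s / n k)) Y (n k) ω ∂μ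
    have hI : 0 ≤ I := integral_nonneg fun ω =>
      Finset.sum_nonneg fun p _ => (closeInd_isUnitPeriodic _).nonneg _
    calc _ ≤ (2 / (n k : ℝ)) ^ 2 * (((n k : ℝ)) ^ 4 * (2 * (C * r ^ k))
          + (2 * (k : ℝ) + 1) ^ 2 * I) := mul_le_mul_of_nonneg_left hv (by positivity)
      _ = 8 * C * ((k : ℝ) ^ 8 * r ^ k)
          + (2 / (k : ℝ) ^ 4 * (2 * (k : ℝ) + 1) ^ 2) * (2 / (n k : ℝ) * I) := by
        rw [hnr]
        field_simp
        ring
      _ ≤ 8 * C * ((k : ℝ) ^ 8 * r ^ k)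
          + (2 / (k : ℝ) ^ 4 * (3 * (k : ℝ)) ^ 2) * B := by
        gcongr
        linarith
      _ = _ := by
        field_simp
        ring
  · simp_rw [integral_const_mul]
    exact hE.comp hpow

end Probability

/-! ### Interpolation between fourth powers -/

lemma mul_pairCorrelation_le (x : ℕ → ℝ) {s t : ℝ} {M N : ℕ} (hM : 0 < M) (hMN : M ≤ N)
    (hst : s / M ≤ t / N) : M * pairCorrelation x s M ≤ N * pairCorrelation x t N := by
  have hMr : (M : ℝ) ≠ 0 := by exact_mod_cast hM.ne'
  have hNr : (N : ℝ) ≠ 0 := by exact_mod_cast (hM.trans_le hMN).ne'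
  unfold pairCorrelation
  rw [← mul_assoc, ← mul_assoc, mul_one_div_cancel hMr, mul_one_div_cancel hNr, one_mul, one_mul]
  refine Nat.cast_le.2 (Finset.card_le_card fun p hp => ?_)
  simp only [Finset.mem_filter, Finset.mem_product, Finset.mem_range] at hp ⊢
  exact ⟨⟨by omega, by omega⟩, hp.2.1, hp.2.2.trans hst⟩

/-- The integer part of the fourth root. -/
def fourthRoot (N : ℕ) : ℕ := N.sqrt.sqrt

lemma fourthRoot_pow_le (N : ℕ) : fourthRoot N ^ 4 ≤ N := by
  calc fourthRoot N ^ 4 = (N.sqrt.sqrt ^ 2) ^ 2 := by rw [fourthRoot]; ring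
    _ ≤ N.sqrt ^ 2 := Nat.pow_le_pow_left (Nat.sqrt_le' _) 2
    _ ≤ N := Nat.sqrt_le' _

lemma lt_fourthRoot_succ_pow (N : ℕ) : N < (fourthRoot N + 1) ^ 4 := by
  calc N < (N.sqrt + 1) ^ 2 := Nat.lt_succ_sqrt' N
    _ ≤ ((N.sqrt.sqrt + 1) ^ 2) ^ 2 := Nat.pow_le_pow_left (Nat.lt_succ_sqrt' _) 2
    _ = (fourthRoot N + 1) ^ 4 := by rw [fourthRoot]; ring

lemma tendsto_fourthRoot : Tendsto fourthRoot atTop atTop := by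
  refine tendsto_atTop.2 fun b => ?_
  filter_upwards [eventually_ge_atTop (b ^ 4)] with N hN
  have h := lt_of_le_of_lt hN (lt_fourthRoot_succ_pow N)
  exact Nat.lt_succ_iff.1 (lt_of_pow_lt_pow_left₀ 4 (Nat.zero_le _) h)

lemma tendsto_succ_pow_div_pow :
    Tendsto (fun k : ℕ => ((k : ℝ) + 1) ^ 4 / (k : ℝ) ^ 4) atTop (𝓝 1) := by
  have h : Tendsto (fun k : ℕ => (1 + 1 / (k : ℝ)) ^ 4) atTop (𝓝 1) := by
    simpa using ((tendsto_const_nhds (x := (1 : ℝ))).add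
      (tendsto_const_div_atTop_nhds_zero_nat 1)).pow 4
  refine h.congr' ?_
  filter_upwards [eventually_gt_atTop 0] with k hk
  have : (k : ℝ) ≠ 0 := by exact_mod_cast hk.ne'
  rw [← div_pow, add_div, div_self this]

lemma tendsto_fourthRoot_succ_pow_div :
    Tendsto (fun N : ℕ => ((fourthRoot N : ℝ) + 1) ^ 4 / N) atTop (𝓝 1) := by
  refine tendsto_of_tendsto_of_tendsto_of_le_of_le' tendsto_const_nhds
    (tendsto_succ_pow_div_pow.comp tendsto_fourthRoot) ?_ ?_
  · filter_upwards [eventually_gt_atTop 0] with N hN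
    have hNr : (0 : ℝ) < N := by exact_mod_cast hN
    rw [le_div_iff₀ hNr, one_mul]
    exact_mod_cast (lt_fourthRoot_succ_pow N).le
  · filter_upwards [tendsto_fourthRoot.eventually_gt_atTop 0] with N hN
    have hr : (0 : ℝ) < fourthRoot N := by exact_mod_cast hN
    have : (fourthRoot N : ℝ) ^ 4 ≤ N := by exact_mod_cast fourthRoot_pow_le N
    exact div_le_div_of_nonneg_left (by positivity) (by positivity) this

lemma tendsto_fourthRoot_pow_div :
    Tendsto (fun N : ℕ => (fourthRoot N : ℝ) ^ 4 / N) atTop (𝓝 1) := by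
  have h := tendsto_fourthRoot_succ_pow_div.div
    (tendsto_succ_pow_div_pow.comp tendsto_fourthRoot) one_ne_zero
  rw [div_one] at h
  refine h.congr' ?_
  filter_upwards [tendsto_fourthRoot.eventually_gt_atTop 0, eventually_gt_atTop 0] with N hN hN0
  have hr : (fourthRoot N : ℝ) ≠ 0 := by exact_mod_cast hN.ne'
  have hNr : (N : ℝ) ≠ 0 := by exact_mod_cast hN0.ne'
  have : (fourthRoot N : ℝ) + 1 ≠ 0 := by positivity
  simp only [Pi.div_apply, Function.comp]
  field_simp

/-- Convergence of the pair correlation statistic along fourth powers, for all positive rational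
scales, gives Poissonian pair correlations. -/
lemma hasPoissonianPairCorrelations_of_pow_four {x : ℕ → ℝ}
    (hx : ∀ q : ℚ, 0 < q →
      Tendsto (fun k : ℕ => pairCorrelation x q (k ^ 4)) atTop (𝓝 (2 * (q : ℝ)))) :
    HasPoissonianPairCorrelations x := by
  intro s hs
  refine tendsto_order.2 ⟨fun b hb => ?_, fun b hb => ?_⟩
  -- A rational scale slightly below s absorbs the ratio of N to the fourth power below it; the
  -- maximum with 0 keeps q positive.
  · obtain ⟨q, hq1, hq2⟩ := exists_rat_btwn (max_lt (by linarith : b / 2 < s) hs)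
    have hq0 : (0 : ℝ) < q := (le_max_right _ _).trans_lt hq1
    have hqb : b < 2 * (q : ℝ) := by linarith [(le_max_left (b / 2) 0).trans_lt hq1]
    have h1 := tendsto_fourthRoot_pow_div.mul
      ((hx q (by exact_mod_cast hq0)).comp tendsto_fourthRoot)
    have h2 := tendsto_fourthRoot_pow_div.const_mul s
    rw [one_mul] at h1
    rw [mul_one] at h2
    filter_upwards [h1.eventually (Ioi_mem_nhds hqb), h2.eventually (Ioi_mem_nhds hq2),
      tendsto_fourthRoot.eventually_gt_atTop 0, eventually_gt_atTop 0] with N hN1 hN2 hN3 hN4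
    have hr : (0 : ℝ) < fourthRoot N := by exact_mod_cast hN3
    have hNr : (0 : ℝ) < N := by exact_mod_cast hN4
    simp only [Function.comp] at hN1 hN2
    have h3 := mul_pairCorrelation_le x (s := q) (t := s) (pow_pos hN3 4) (fourthRoot_pow_le N) (by
      rw [← mul_div_assoc, lt_div_iff₀ hNr] at hN2
      rw [div_le_div_iff₀ (by positivity) hNr]
      push_cast
      exact hN2.le)
    rw [div_mul_eq_mul_div, lt_div_iff₀ hNr] at hN1
    push_cast at h3
    refine lt_of_mul_lt_mul_right ?_ hNr.le
    linarith
  · obtain ⟨q, hq1, hq2⟩ := exists_rat_btwn (by linarith : s < b / 2)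
    have hq0 : (0 : ℝ) < q := hs.trans hq1
    have hqb : 2 * (q : ℝ) < b := by linarith
    have h1 := tendsto_fourthRoot_succ_pow_div.mul
      ((hx q (by exact_mod_cast hq0)).comp ((tendsto_add_atTop_nat 1).comp tendsto_fourthRoot))
    have h2 := tendsto_fourthRoot_succ_pow_div.const_mul s
    rw [one_mul] at h1
    rw [mul_one] at h2
    filter_upwards [h1.eventually (Iio_mem_nhds hqb), h2.eventually (Iio_mem_nhds hq1),
      eventually_gt_atTop 0] with N hN1 hN2 hN4
    have hNr : (0 : ℝ) < N := by exact_mod_cast hN4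
    simp only [Function.comp] at hN1 hN2
    have h3 := mul_pairCorrelation_le x (s := s) (t := q) hN4 (lt_fourthRoot_succ_pow N).le (by
      rw [← mul_div_assoc, div_lt_iff₀ hNr] at hN2
      rw [div_le_div_iff₀ hNr (by positivity)]
      push_cast
      exact hN2.le)
    rw [div_mul_eq_mul_div, div_lt_iff₀ hNr] at hN1
    push_cast at h3
    refine lt_of_mul_lt_mul_right ?_ hNr.le
    linarith

theorem theorem3 {Ω : Type*} [MeasurableSpace Ω] (μ : Measure Ω) [IsProbabilityMeasure μ]
    (D : Measure ℝ) (hD_supp : D (Set.Ico 0 1) = 1) (hD_density : HasLebesgueDensity D)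
    (Y : ℕ → Ω → ℝ) (hY_indep : iIndepFun Y μ) (hY_law : ∀ n, HasLaw (Y n) D μ)
    (x₁ : ℝ) (hx₁ : x₁ ∈ Set.Ico (0 : ℝ) 1) :
    ∀ᵐ ω ∂μ, HasPoissonianPairCorrelations (torusWalk x₁ (fun n => Y n ω)) := by
  have hD : IsProbabilityMeasure D := by
    rw [← (hY_law 0).map_eq]
    exact Measure.isProbabilityMeasure_map (hY_law 0).aemeasurable
  -- `HasLaw` gives only a.e. measurability, so measurable versions replace the steps.
  set Z : ℕ → Ω → ℝ := fun n => (hY_law n).aemeasurable.mk (Y n)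
  have hYZ : ∀ n, Y n =ᵐ[μ] Z n := fun n => (hY_law n).aemeasurable.ae_eq_mk
  have hZm : ∀ n, Measurable (Z n) := fun n => (hY_law n).aemeasurable.measurable_mk
  have hZi : iIndepFun Z μ := hY_indep.congr hYZ
  have hZl : ∀ n, μ.map (Z n) = D := fun n => by
    rw [← Measure.map_congr (hYZ n), (hY_law n).map_eq]
  have hall : ∀ᵐ ω ∂μ, ∀ q : ℚ, 0 < q → Tendsto (fun k : ℕ => 2 / ((k ^ 4 : ℕ) : ℝ) *
      pairSum (closeInd ((q : ℝ) / (k ^ 4 : ℕ))) Z (k ^ 4) ω) atTop (𝓝 (2 * (q : ℝ))) := by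
    rw [ae_all_iff]
    intro q
    by_cases hq : 0 < q
    · filter_upwards [ae_tendsto_pairSum_pow_four hD_density hZi hZm hZl
        (by exact_mod_cast hq : (0 : ℝ) < q)] with ω hω _ using hω
    · exact Eventually.of_forall fun _ h => absurd h hq
  filter_upwards [hall, ae_all_iff.2 hYZ] with ω h1 h2
  have h3 : (fun n => Y n ω) = fun n => Z n ω := funext h2
  rw [h3]
  refine hasPoissonianPairCorrelations_of_pow_four fun q hq => ?_
  simp_rw [pairCorrelation_torusWalk]
  exact h1 q hq

end
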